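/- For a finite string $S=S[1]\cdots S[n]$ over some alphabet, a pair $(i,j)$ with $1\le i<j\le n$ is a (nontrivial) maximal palindrome of $S$ if $S[i..j]$ is a palindrome and either $i=1$, or $j=n$, or $S[i-1]\neq S[j+1]$. The set $PF(S)$ of all these pairs, together with the length $n$, is the palindromic fingerprint of $S$. A pair $(F,n)$ is a palindromic fingerprint of length $n$ if it is the palindromic fingerprint of some string of length $n$; every such string is called a preimage of $(F,n)$. We say that $(F,n)$ cannot be reconstructed with fewer than $k$ characters if every preimage of $(F,n)$ contains at least $k$ distinct characters. Let $P_1=1$ and $P_j=P_{j-1}\,j\,P_{j-1}$ for $j\ge 2$ be the Zimin words. Let $k\ge 3$, let $x\neq y$ be two characters that do not occur in $P_{k-2}$, and let $S_k=x\,P_{k-2}\,y$. Then the palindromic fingerprint of $S_k$ is the unique shortest palindromic fingerprint that cannot be reconstructed with fewer than $k$ characters, that is: 1. The palindromic fingerprint $(PF(S_k),|S_k|)$ cannot be reconstructed with fewer than $k$ characters. 2. Every palindromic fingerprint that cannot be reconstructed with fewer than $k$ characters has length at least $|S_k|$. 3. Every palindromic fingerprint of length $|S_k|$ that cannot be reconstructed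 with fewer than $k$ characters is equal to the fingerprint of $S_k$. Moreover, the preimages of this fingerprint are unique up to renaming of letters: a string over any alphabet is a preimage of $(PF(S_k),|S_k|)$ if and only if it is obtained from $S_k$ by an injective renaming of its letters. -/

import Mathlib

namespace PalFingerprint

/-- The Zimin words: `P 1 = 1` and `P (j+1) = P j (j+1) P j`, started from the empty word `P 0`. -/
def zimin : ℕ → List ℕ
  | 0 => []
  | j + 1 => zimin j ++ [j + 1] ++ zimin j

/-- The substring `w[i..j]`, with positions counted from `1`. -/
def substring {α : Type*} (w : List α) (i j : ℕ) : List α :=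
  (w.take j).drop (i - 1)

/-- `(i, j)` is a palindromic descriptor of `w`: the positions satisfy `1 ≤ i ≤ j ≤ |w|` and
the substring `w[i..j]` is a palindrome. -/
def IsPal {α : Type*} (w : List α) (i j : ℕ) : Prop :=
  1 ≤ i ∧ i ≤ j ∧ j ≤ w.length ∧ (substring w i j).Palindrome

/-- `(i, j)` is a maximal palindrome of `w`: `(i - 1, j + 1)` is either out of range or
does not describe a palindrome (for `i = 1` the truncated `i - 1 = 0` is out of range). -/
def IsMaxPal {α : Type*} (w : List α) (i j : ℕ) : Prop :=
  IsPal w i j ∧ ¬ IsPal w (i - 1) (j + 1)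

/-- The palindromic fingerprint: the set of all nontrivial (length at least two) maximal
palindromes of `w`. -/
def PF {α : Type*} (w : List α) : Set (ℕ × ℕ) :=
  {p | p.1 < p.2 ∧ IsMaxPal w p.1 p.2}

/-- `w` is a preimage of `(F, n)`: a string of length `n` whose palindromic fingerprint
is `F`. -/
def IsPreimage {α : Type*} (w : List α) (F : Set (ℕ × ℕ)) (n : ℕ) : Prop :=
  w.length = n ∧ PF w = F

/-- `(F, n)` is a (valid) palindromic fingerprint of length `n`. Strings are finite, so the
countably infinite alphabet `ℕ` is no restriction. -/
def IsFingerprint (F : Set (ℕ × ℕ)) (n : ℕ) : Prop :=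
  ∃ w : List ℕ, IsPreimage w F n

/-- `(F, n)` cannot be reconstructed with fewer than `k` characters: every preimage contains
at least `k` distinct characters. -/
def RequiresChars (F : Set (ℕ × ℕ)) (n k : ℕ) : Prop :=
  ∀ w : List ℕ, IsPreimage w F n → k ≤ w.toFinset.card

end PalFingerprint

namespace PalFingerprint

/-! ### Palindromes of words viewed as functions on positions -/

section Functions

variable {β γ : Type*}

/-! Rebuild a word from its palindromes greedily, left to right. The letter at `p + 1` is
constrained only by the letters that precede palindromic suffixes of the prefix of length `p`: it
must agree with or differ from each of them. Which of those letters coincide is already fixed by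
palindromes inside the prefix (`eq_iff_palOn`). Hence `m + 1` letters can fail only if at least `m +
1` distinct letters precede palindromic suffixes and the next letter differs from them all
(`exists_samePal_lt`).

For each preceding letter, take the shortest suffix it precedes. A periodicity argument gives `2 * l
+ 1 ≤ l'` for any two such lengths `l < l'` (`firstLengths_doubling`). So failure forces `p ≥ 2 ^
m`, that is, length at least `2 ^ m + 1`, which is the length of `S` for `m = k - 2`. At equality
the lengths are exactly `2 ^ i - 1` for `i ≤ m`, and reflecting in these palindromes determines all
coincidences of letters (`ZiminLike.kernel_eq`). This structure is visible in the palindromes alone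
(`ZiminLike.of_samePal`), so every preimage is a renaming of `S`. -/

/-- The factor of `h` on the positions `i, …, j` is a palindrome. -/
def PalOn (h : ℕ → β) (i j : ℕ) : Prop :=
  ∀ a b, a + b = i + j → i ≤ a → i ≤ b → h a = h b

/-- `g` and `h` have the same palindromes within the positions `1, …, n`. -/
def SamePal (g : ℕ → γ) (h : ℕ → β) (n : ℕ) : Prop :=
  ∀ i j, 1 ≤ i → i ≤ j → j ≤ n → (PalOn g i j ↔ PalOn h i j)

theorem PalOn.of_lt {h : ℕ → β} {i j : ℕ} (hij : j < i) : PalOn h i j := by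
  intro a b _ _ _; omega

theorem PalOn.self (h : ℕ → β) (i : ℕ) : PalOn h i i := by
  intro a b _ _ _
  have : a = b := by omega
  rw [this]

theorem palOn_iff_inner {h : ℕ → β} {i j : ℕ} (hij : i < j + 1) :
    PalOn h i (j + 1) ↔ h i = h (j + 1) ∧ PalOn h (i + 1) j := by
  constructor
  · intro H
    exact ⟨H _ _ rfl le_rfl hij.le, fun a b hab ha hb => H a b (by omega) (by omega) (by omega)⟩
  · rintro ⟨h1, h2⟩ a b hab ha hb
    rcases ha.eq_or_lt with rfl | ha'
    · have : b = j + 1 := by omega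
      rw [this, h1]
    · rcases hb.eq_or_lt with rfl | hb'
      · have : a = j + 1 := by omega
        rw [this, h1]
      · exact h2 a b (by omega) ha' hb'

theorem palOn_congr_kernel {g : ℕ → γ} {h : ℕ → β} {n i j : ℕ}
    (H : ∀ s t, 1 ≤ s → s ≤ n → 1 ≤ t → t ≤ n → (g s = g t ↔ h s = h t))
    (hi : 1 ≤ i) (hj : j ≤ n) : PalOn g i j ↔ PalOn h i j := by
  constructor
  · intro hp a b hab ha hb
    exact (H a b (by omega) (by omega) (by omega) (by omega)).1 (hp a b hab ha hb)
  · intro hp a b hab ha hb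
    exact (H a b (by omega) (by omega) (by omega) (by omega)).2 (hp a b hab ha hb)

theorem SamePal.palOn_iff {g : ℕ → γ} {h : ℕ → β} {n i j : ℕ} (H : SamePal g h n)
    (hi : 1 ≤ i) (hj : j ≤ n) : PalOn g i j ↔ PalOn h i j := by
  by_cases hij : i ≤ j
  · exact H i j hi hij hj
  · exact iff_of_true (.of_lt (by omega)) (.of_lt (by omega))

theorem SamePal.mono {g : ℕ → γ} {h : ℕ → β} {n p : ℕ} (H : SamePal g h n) (hp : p ≤ n) :
    SamePal g h p :=
  fun i j hi hij hj => H i j hi hij (hj.trans hp)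

/-! ### Palindromic suffixes and greedy reconstruction -/

/-- For two palindromic suffixes of a prefix, whether the letters preceding them agree is
itself recorded by a palindrome inside the prefix. -/
theorem eq_iff_palOn {h : ℕ → β} {p i j : ℕ} (hij : i < j) (hj : j ≤ p)
    (Hi : PalOn h (i + 1) p) (Hj : PalOn h (j + 1) p) :
    h i = h j ↔ PalOn h i (i + (p - j) + 1) := by
  -- Reflection in the longer suffix sends `j` to `i + (p - j) + 1` and the shorter suffix to the
  -- factor between `i` and that image.
  rw [palOn_iff_inner (by omega), Hi j (i + (p - j) + 1) (by omega) (by omega) (by omega)]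
  refine ⟨fun e => ⟨e, fun a b hab ha hb => ?_⟩, fun e => e.1⟩
  rw [Hi a (i + 1 + p - a) (by omega) (by omega) (by omega),
    Hi b (i + 1 + p - b) (by omega) (by omega) (by omega)]
  exact Hj _ _ (by omega) (by omega) (by omega)

/-- The positions preceding a (possibly empty) palindromic suffix of the prefix of length `p`. -/
noncomputable def precSuffix (h : ℕ → β) (p : ℕ) : Finset ℕ := by
  classical exact (Finset.Icc 1 p).filter fun i => PalOn h (i + 1) p

theorem mem_precSuffix {h : ℕ → β} {p i : ℕ} :
    i ∈ precSuffix h p ↔ (1 ≤ i ∧ i ≤ p) ∧ PalOn h (i + 1) p := by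
  classical simp [precSuffix]

theorem SamePal.eq_iff {g : ℕ → γ} {h : ℕ → β} {p : ℕ} (H : SamePal g h p) {i j : ℕ}
    (hi : i ∈ precSuffix h p) (hj : j ∈ precSuffix h p) : g i = g j ↔ h i = h j := by
  wlog hij : i < j generalizing i j
  · rcases (not_lt.1 hij).eq_or_lt with rfl | hlt
    · simp
    · rw [eq_comm, this hj hi hlt, eq_comm]
  rw [mem_precSuffix] at hi hj
  rw [eq_iff_palOn hij hj.1.2 hi.2 hj.2, eq_iff_palOn hij hj.1.2
    ((H.palOn_iff (by omega) le_rfl).2 hi.2) ((H.palOn_iff (by omega) le_rfl).2 hj.2)]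
  exact H.palOn_iff hi.1.1 (by omega)

/-- A palindrome of length at least two ending at `p + 1` is a palindromic suffix of the prefix
enclosed by equal letters, so `ha` covers every new palindrome. -/
theorem SamePal.update {g : ℕ → γ} {h : ℕ → β} {p : ℕ} (H : SamePal g h p) {a : γ}
    (ha : ∀ i ∈ precSuffix h p, g i = a ↔ h i = h (p + 1)) :
    SamePal (Function.update g (p + 1) a) h (p + 1) := by
  have hag : ∀ i j, j ≤ p → 1 ≤ i → (PalOn (Function.update g (p + 1) a) i j ↔ PalOn g i j) := by
    intro i j hj hi
    refine palOn_congr_kernel (n := p) (fun s t _ hs _ ht => ?_) hi hj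
    rw [Function.update_of_ne (by omega), Function.update_of_ne (by omega)]
  intro i j hi hij hj
  rcases hj.eq_or_lt with rfl | hj
  · rcases hij.eq_or_lt with rfl | hij
    · exact iff_of_true (.self _ _) (.self _ _)
    · rw [palOn_iff_inner hij, palOn_iff_inner hij, hag _ _ le_rfl (by omega),
        H.palOn_iff (by omega) le_rfl, Function.update_self, Function.update_of_ne (by omega)]
      refine and_congr_left fun hp => ha i (mem_precSuffix.2 ⟨⟨hi, by omega⟩, hp⟩)
  · rw [hag _ _ (by omega) hi, H.palOn_iff hi (by omega)]

/-- Greedy reconstruction of a word with given palindromes over `c` letters. -/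
theorem exists_samePal_lt [DecidableEq β] {h : ℕ → β} {c n : ℕ} (hc : 0 < c)
    (H : ∀ p < n, ((precSuffix h p).image h).card < c ∨
      ∃ i ∈ precSuffix h p, h i = h (p + 1)) :
    ∃ g : ℕ → ℕ, (∀ t, g t < c) ∧ SamePal g h n := by
  induction n with
  | zero => exact ⟨fun _ => 0, fun _ => hc, fun i j _ _ _ => by omega⟩
  | succ p ih =>
    obtain ⟨g, hg, hs⟩ := ih fun q hq => H q (by omega)
    suffices ∃ a < c, ∀ i ∈ precSuffix h p, g i = a ↔ h i = h (p + 1) by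
      obtain ⟨a, hac, ha⟩ := this
      refine ⟨Function.update g (p + 1) a, fun t => ?_, hs.update ha⟩
      by_cases ht : t = p + 1
      · subst ht; simpa using hac
      · rw [Function.update_of_ne ht]; exact hg t
    by_cases hex : ∃ i ∈ precSuffix h p, h i = h (p + 1)
    · obtain ⟨i, hi, e⟩ := hex
      exact ⟨g i, hg i, fun j hj => by rw [hs.eq_iff hj hi, e]⟩
    · have hcard := (H p (by omega)).resolve_right hex
      -- By `SamePal.eq_iff`, `g` and `h` have the same coincidences on `precSuffix h p`; hence `g`
      -- leaves one of the `c` letters free.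
      have hle : ((precSuffix h p).image g).card ≤ ((precSuffix h p).image h).card := by
        have hex' : ∀ b ∈ (precSuffix h p).image g, ∃ i ∈ precSuffix h p, g i = b := by
          intro b hb; simpa using hb
        choose! r hr hr' using hex'
        refine Finset.card_le_card_of_injOn (fun b => h (r b))
          (fun b hb => Finset.mem_coe.2 (Finset.mem_image_of_mem h (hr b hb))) ?_
        intro b hb b' hb' e
        rw [← hr' b hb, ← hr' b' hb']
        exact (hs.eq_iff (hr b hb) (hr b' hb')).2 e
      obtain ⟨a, ha, ha'⟩ := Finset.exists_mem_notMem_of_card_lt_card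
        (s := (precSuffix h p).image g) (t := Finset.range c)
        (by rw [Finset.card_range]; omega)
      refine ⟨a, Finset.mem_range.1 ha, fun i hi => iff_of_false (fun e => ha' ?_)
        fun e => hex ⟨i, hi, e⟩⟩
      exact e ▸ Finset.mem_image_of_mem g hi

/-! ### Doubling sets and lengths of palindromic suffixes -/

/-- Each block `[2 ^ c - 1, 2 ^ (c + 1) - 1)` holds at most one element of `K`, because doubling its
left end plus one already leaves it. -/
theorem card_le_of_doubling {K : Finset ℕ} {c : ℕ}
    (hK : ∀ l ∈ K, ∀ l' ∈ K, l < l' → 2 * l + 1 ≤ l') (hr : ∀ l ∈ K, l + 1 < 2 ^ c) :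
    K.card ≤ c := by
  induction c generalizing K with
  | zero =>
    rw [Nat.le_zero, Finset.card_eq_zero, Finset.eq_empty_iff_forall_notMem]
    intro l hl
    have := hr l hl
    simp at this
  | succ c ih =>
    have h1 : (K.filter fun l => l + 1 < 2 ^ c).card ≤ c :=
      ih (fun l hl l' hl' => hK l (Finset.mem_filter.1 hl).1 l' (Finset.mem_filter.1 hl').1)
        fun l hl => (Finset.mem_filter.1 hl).2
    have h2 : (K.filter fun l => ¬ l + 1 < 2 ^ c).card ≤ 1 := by
      refine Finset.card_le_one.2 fun a ha b hb => ?_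
      rw [Finset.mem_filter] at ha hb
      have ha' := hr a ha.1
      have hb' := hr b hb.1
      rw [pow_succ] at ha' hb'
      rcases lt_trichotomy a b with h | h | h
      · have := hK a ha.1 b hb.1 h; omega
      · exact h
      · have := hK b hb.1 a ha.1 h; omega
    have := K.card_filter_add_card_filter_not (fun l => l + 1 < 2 ^ c)
    omega

/-- The extremal case of `card_le_of_doubling`: the top value must occur, and doubling then confines
the other elements below half the range. -/
theorem mem_of_doubling {K : Finset ℕ} {m : ℕ}
    (hK : ∀ l ∈ K, ∀ l' ∈ K, l < l' → 2 * l + 1 ≤ l') (hr : ∀ l ∈ K, l < 2 ^ m)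
    (hc : m + 1 ≤ K.card) : ∀ i ≤ m, 2 ^ i - 1 ∈ K := by
  induction m generalizing K with
  | zero =>
    intro i hi
    obtain ⟨l, hl⟩ := Finset.card_pos.1 (by omega : 0 < K.card)
    have := hr l hl
    obtain rfl : l = 0 := by simpa using this
    obtain rfl : i = 0 := by omega
    simpa using hl
  | succ m ih =>
    have htop : 2 ^ (m + 1) - 1 ∈ K := by
      by_contra hn
      have := card_le_of_doubling (c := m + 1) hK fun l hl => by
        have h1 := hr l hl
        have h2 : l ≠ 2 ^ (m + 1) - 1 := by rintro rfl; exact hn hl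
        omega
      omega
    intro i hi
    rcases hi.eq_or_lt with rfl | hi
    · exact htop
    · refine Finset.mem_of_mem_erase (ih (K := K.erase (2 ^ (m + 1) - 1)) ?_ ?_ ?_ i (by omega))
      · exact fun l hl l' hl' =>
          hK l (Finset.mem_of_mem_erase hl) l' (Finset.mem_of_mem_erase hl')
      · intro l hl
        rw [Finset.mem_erase] at hl
        have h1 := hr l hl.2
        have h2 := hK l hl.2 _ htop (by omega)
        rw [pow_succ] at h2
        have := Nat.one_le_two_pow (n := m)
        omega
      · rw [Finset.card_erase_of_mem htop]; omega

/-- The lengths of the palindromic suffixes of the prefix of length `p` that are the shortest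
ones preceded by their letter. -/
noncomputable def firstLengths (h : ℕ → β) (p : ℕ) : Finset ℕ := by
  classical exact (Finset.range p).filter fun l => p - l ∈ precSuffix h p ∧
    ∀ l' < l, p - l' ∈ precSuffix h p → h (p - l') ≠ h (p - l)

theorem mem_firstLengths {h : ℕ → β} {p l : ℕ} :
    l ∈ firstLengths h p ↔ l < p ∧ p - l ∈ precSuffix h p ∧
      ∀ l' < l, p - l' ∈ precSuffix h p → h (p - l') ≠ h (p - l) := by
  classical simp [firstLengths]

/-- If `l' ≤ 2 * l`, the longer suffix has period `l' - l`. Shifting by it gives a palindromic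
suffix of length `2 * l - l'` preceded by the same letter as the one of length `l`, against
minimality. -/
theorem firstLengths_doubling {h : ℕ → β} {p : ℕ} {l l' : ℕ} (hl : l ∈ firstLengths h p)
    (hl' : l' ∈ firstLengths h p) (hlt : l < l') : 2 * l + 1 ≤ l' := by
  by_contra hcon
  rw [mem_firstLengths] at hl hl'
  have hu := (mem_precSuffix.1 hl.2.1).2
  have hv := (mem_precSuffix.1 hl'.2.1).2
  have period : ∀ a, p - l' < a → a ≤ p - (l' - l) → h a = h (a + (l' - l)) := by
    intro a h1 h2
    rw [hv a (p - l' + 1 + p - a) (by omega) (by omega) (by omega)]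
    exact hu _ _ (by omega) (by omega) (by omega)
  refine hl.2.2 (2 * l - l') (by omega) (mem_precSuffix.2 ⟨⟨by omega, by omega⟩, ?_⟩) ?_
  · intro a b hab ha hb
    have e := period (b - (l' - l)) (by omega) (by omega)
    rw [Nat.sub_add_cancel (by omega)] at e
    rw [← e]
    exact hu _ _ (by omega) (by omega) (by omega)
  · rw [period (p - l) (by omega) (by omega)]
    congr 1; omega

theorem card_image_le_card_firstLengths [DecidableEq β] (h : ℕ → β) (p : ℕ) :
    ((precSuffix h p).image h).card ≤ (firstLengths h p).card := by
  classical
  refine le_trans (Finset.card_le_card (t := (firstLengths h p).image fun l => h (p - l)) ?_)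
    Finset.card_image_le
  intro b hb
  obtain ⟨i, hi, rfl⟩ := Finset.mem_image.1 hb
  have hi' := mem_precSuffix.1 hi
  have hex : ∃ l, p - l ∈ precSuffix h p ∧ l < p ∧ h (p - l) = h i := by
    refine ⟨p - i, ?_, by omega, ?_⟩ <;> rw [Nat.sub_sub_self hi'.1.2]
    exact hi
  obtain ⟨h1, h2, h3⟩ := Nat.find_spec hex
  refine Finset.mem_image.2 ⟨Nat.find hex, mem_firstLengths.2 ⟨h2, h1, fun l' hl' hm e => ?_⟩, h3⟩
  exact Nat.find_min hex hl' ⟨hm, by omega, e.trans h3⟩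

/-! ### Zimin-like words -/

/-- On the positions `1, …, 2 ^ m + 1`, the word `h` has the palindromes, and the distinct
letters around them, that make it a renaming of `x P_m y`. -/
structure ZiminLike (h : ℕ → β) (m : ℕ) : Prop where
  pal : ∀ i ≤ m, PalOn h (2 ^ m - 2 ^ i + 2) (2 ^ m)
  ne : ∀ i j, i < j → j ≤ m → h (2 ^ m - 2 ^ i + 1) ≠ h (2 ^ m - 2 ^ j + 1)
  last_ne : ∀ i ≤ m, h (2 ^ m - 2 ^ i + 1) ≠ h (2 ^ m + 1)

/-- Where the greedy construction fails, the doubling bound leaves no slack: `p = 2 ^ m`, and the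
first lengths include every `2 ^ i - 1`. -/
theorem exists_samePal_or_ziminLike (h : ℕ → β) {m n : ℕ} (hn : n ≤ 2 ^ m + 1) :
    (∃ g : ℕ → ℕ, (∀ t, g t < m + 1) ∧ SamePal g h n) ∨ (n = 2 ^ m + 1 ∧ ZiminLike h m) := by
  classical
  by_cases H : ∀ p < n, ((precSuffix h p).image h).card < m + 1 ∨
      ∃ i ∈ precSuffix h p, h i = h (p + 1)
  · exact .inl (exists_samePal_lt (by omega) H)
  · push Not at H
    obtain ⟨p, hp, hcard, hne⟩ := H
    have hcard' := hcard.trans (card_image_le_card_firstLengths h p)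
    have hd : ∀ l ∈ firstLengths h p, ∀ l' ∈ firstLengths h p, l < l' → 2 * l + 1 ≤ l' :=
      fun l hl l' hl' => firstLengths_doubling hl hl'
    have hpm : p = 2 ^ m := by
      by_contra hpm
      have := card_le_of_doubling (c := m) hd fun l hl => by
        have := (mem_firstLengths.1 hl).1
        omega
      omega
    subst hpm
    have hmem := mem_of_doubling hd (fun l hl => (mem_firstLengths.1 hl).1) hcard'
    have hidx : ∀ i ≤ m, 2 ^ m - (2 ^ i - 1) = 2 ^ m - 2 ^ i + 1 := fun i hi => by
      have := Nat.pow_le_pow_right (n := 2) (by norm_num) hi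
      have := Nat.one_le_two_pow (n := i)
      omega
    have hprec : ∀ i ≤ m, 2 ^ m - 2 ^ i + 1 ∈ precSuffix h (2 ^ m) := fun i hi =>
      hidx i hi ▸ (mem_firstLengths.1 (hmem i hi)).2.1
    refine .inr ⟨by omega, fun i hi => (mem_precSuffix.1 (hprec i hi)).2, fun i j hij hj => ?_,
      fun i hi => hne _ (hprec i hi)⟩
    have hlt : 2 ^ i - 1 < 2 ^ j - 1 := by
      have := Nat.pow_lt_pow_right (a := 2) (by norm_num) hij
      have := Nat.one_le_two_pow (n := i)
      omega
    have := (mem_firstLengths.1 (hmem j hj)).2.2 _ hlt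
    rw [hidx i (by omega), hidx j hj] at this
    exact this (hprec i (by omega))

/-- In Zimin-like words every position carries the letter of a common representative. -/
theorem ZiminLike.exists_representative_of_lt {g : ℕ → γ} {h : ℕ → β} {m : ℕ}
    (hg : ZiminLike g m) (hh : ZiminLike h m) {d j : ℕ} (hj : j ≤ m) (hd : d + 1 < 2 ^ j) :
    ∃ i < j, g (2 ^ m - d) = g (2 ^ m - 2 ^ i + 1) ∧ h (2 ^ m - d) = h (2 ^ m - 2 ^ i + 1) := by
  induction j generalizing d with
  | zero => simp at hd
  | succ j ih =>
    have hle := Nat.pow_le_pow_right (n := 2) (by norm_num) hj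
    have hpos := Nat.one_le_two_pow (n := j)
    have hgp := hg.pal _ hj
    have hhp := hh.pal _ hj
    rw [pow_succ] at hd hle hgp hhp
    rcases lt_trichotomy (d + 1) (2 ^ j) with hlt | heq | hgt
    · obtain ⟨i, hi, e⟩ := ih (by omega) hlt
      exact ⟨i, by omega, e⟩
    · refine ⟨j, by omega, ?_⟩
      rw [show 2 ^ m - d = 2 ^ m - 2 ^ j + 1 by omega]
      exact ⟨rfl, rfl⟩
    -- Reflection in the palindromic suffix of length `2 ^ (j + 1) - 1`, common to both words, turns
    -- distance `d` from its end into `2 ^ (j + 1) - 2 - d`.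
    · obtain ⟨i, hi, e⟩ := ih (d := 2 ^ j * 2 - 2 - d) (by omega) (by omega)
      refine ⟨i, by omega, ?_⟩
      rw [hgp (2 ^ m - d) (2 ^ m - (2 ^ j * 2 - 2 - d)) (by omega) (by omega) (by omega),
        hhp (2 ^ m - d) (2 ^ m - (2 ^ j * 2 - 2 - d)) (by omega) (by omega) (by omega)]
      exact e

theorem ZiminLike.exists_representative {g : ℕ → γ} {h : ℕ → β} {m : ℕ}
    (hg : ZiminLike g m) (hh : ZiminLike h m) {t : ℕ} (h1 : 1 ≤ t) (h2 : t ≤ 2 ^ m) :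
    ∃ i ≤ m, g t = g (2 ^ m - 2 ^ i + 1) ∧ h t = h (2 ^ m - 2 ^ i + 1) := by
  rcases h1.eq_or_lt with rfl | h1
  · exact ⟨m, le_rfl, by simp⟩
  · obtain ⟨i, hi, e⟩ := hg.exists_representative_of_lt hh (d := 2 ^ m - t) le_rfl (by omega)
    rw [Nat.sub_sub_self h2] at e
    exact ⟨i, hi.le, e⟩

theorem ZiminLike.eq_iff {h : ℕ → β} {m i j : ℕ} (hh : ZiminLike h m) (hi : i ≤ m)
    (hj : j ≤ m) : h (2 ^ m - 2 ^ i + 1) = h (2 ^ m - 2 ^ j + 1) ↔ i = j := by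
  refine ⟨fun e => ?_, fun e => e ▸ rfl⟩
  rcases lt_trichotomy i j with hlt | heq | hgt
  · exact (hh.ne i j hlt hj e).elim
  · exact heq
  · exact (hh.ne j i hgt hi e.symm).elim

/-- Any two Zimin-like words are renamings of each other. -/
theorem ZiminLike.kernel_eq {g : ℕ → γ} {h : ℕ → β} {m : ℕ} (hg : ZiminLike g m)
    (hh : ZiminLike h m) (s t : ℕ) (hs : 1 ≤ s) (hs' : s ≤ 2 ^ m + 1) (ht : 1 ≤ t)
    (ht' : t ≤ 2 ^ m + 1) : g s = g t ↔ h s = h t := by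
  rcases hs'.eq_or_lt with rfl | hs'
  · rcases ht'.eq_or_lt with rfl | ht'
    · simp
    · obtain ⟨i, hi, e, e'⟩ := hg.exists_representative hh ht (by omega)
      rw [e, e']
      exact iff_of_false (hg.last_ne i hi).symm (hh.last_ne i hi).symm
  · obtain ⟨i, hi, e, e'⟩ := hg.exists_representative hh hs (by omega)
    rw [e, e']
    rcases ht'.eq_or_lt with rfl | ht'
    · exact iff_of_false (hg.last_ne i hi) (hh.last_ne i hi)
    · obtain ⟨j, hj, e, e'⟩ := hg.exists_representative hh ht (by omega)
      rw [e, e', hg.eq_iff hi hj, hh.eq_iff hi hj]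

/-- The inequalities transfer too: those between preceding letters by `SamePal.eq_iff`, those with
the last letter because equality would create a palindrome ending at `2 ^ m + 1`. -/
theorem ZiminLike.of_samePal {g : ℕ → γ} {h : ℕ → β} {m : ℕ} (hh : ZiminLike h m)
    (H : SamePal g h (2 ^ m + 1)) : ZiminLike g m := by
  have hle : ∀ i ≤ m, 1 ≤ 2 ^ i ∧ 2 ^ i ≤ 2 ^ m := fun i hi =>
    ⟨Nat.one_le_two_pow, Nat.pow_le_pow_right (by norm_num) hi⟩
  have hmem : ∀ i ≤ m, 2 ^ m - 2 ^ i + 1 ∈ precSuffix h (2 ^ m) := fun i hi =>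
    have := hle i hi
    mem_precSuffix.2 ⟨by omega, hh.pal i hi⟩
  have hpal : ∀ i ≤ m, PalOn g (2 ^ m - 2 ^ i + 2) (2 ^ m) := fun i hi =>
    (H.palOn_iff (by omega) (by omega)).2 (hh.pal i hi)
  refine ⟨hpal, fun i j hij hj e => ?_, fun i hi e => ?_⟩
  · exact hh.ne i j hij hj (((H.mono (by omega)).eq_iff (hmem i (by omega)) (hmem j hj)).1 e)
  · have := hle i hi
    refine hh.last_ne i hi ((palOn_iff_inner (by omega)).1 ((H.palOn_iff (by omega) le_rfl).1
      ((palOn_iff_inner (by omega)).2 ⟨e, hpal i hi⟩))).1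

end Functions

/-! ### From lists and fingerprints to functions -/

section Lists

variable {α β : Type*}

/-- The letter of `w` at position `i`, counted from `1`. -/
def letter (w : List α) (i : ℕ) : Option α := w[i - 1]?

theorem isPal_iff_palOn {w : List α} {i j : ℕ} :
    IsPal w i j ↔ 1 ≤ i ∧ i ≤ j ∧ j ≤ w.length ∧ PalOn (letter w) i j := by
  refine and_congr_right fun hi => and_congr_right fun hij => and_congr_right fun hj => ?_
  have hlen : (substring w i j).length = j - (i - 1) := by
    simp only [substring, List.length_drop, List.length_take]; omega
  have hget : ∀ t < j - (i - 1), (substring w i j)[t]? = letter w (i + t) := fun t ht => by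
    rw [substring, List.getElem?_drop, List.getElem?_take_of_lt (by omega), letter]
    congr 1; omega
  rw [List.Palindrome.iff_reverse_eq]
  constructor
  · intro h a b hab ha hb
    have e := congrArg (fun l => l[a - i]?) h
    rw [List.getElem?_reverse (by omega), hget _ (by omega), hget _ (by omega)] at e
    rw [show b = i + ((substring w i j).length - 1 - (a - i)) by omega, e]
    congr 1; omega
  · intro h
    refine List.ext_getElem? fun t => ?_
    by_cases ht : t < (substring w i j).length
    · rw [List.getElem?_reverse ht, hget _ (by omega), hget _ (by omega)]
      exact h _ _ (by omega) (by omega) (by omega)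
    · rw [List.getElem?_eq_none (by simpa using ht), List.getElem?_eq_none (by omega)]

/-- Expand the palindrome about its centre until it is maximal, hence listed in the fingerprint,
then shrink back in the other word. -/
theorem IsPal.of_PF_eq {v : List α} {w : List β} (hlen : v.length = w.length)
    (h : PF v = PF w) {i j : ℕ} (hp : IsPal v i j) : IsPal w i j := by
  rcases hp.2.1.eq_or_lt with rfl | hij
  · exact isPal_iff_palOn.2 ⟨hp.1, le_rfl, hlen ▸ hp.2.2.1, .self _ _⟩
  · by_cases hm : IsPal v (i - 1) (j + 1)
    · have hi := hp.1
      have hw := isPal_iff_palOn.1 (IsPal.of_PF_eq hlen h hm)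
      refine isPal_iff_palOn.2 ⟨by omega, by omega, by omega, ?_⟩
      have := ((palOn_iff_inner (by omega)).1 hw.2.2.2).2
      rwa [Nat.sub_add_cancel hp.1] at this
    · have : (i, j) ∈ PF w := h ▸ ⟨hij, hp, hm⟩
      exact this.2.1
  termination_by i

theorem PF_eq_iff_samePal {v : List α} {w : List β} (hlen : v.length = w.length) :
    PF v = PF w ↔ SamePal (letter v) (letter w) w.length := by
  constructor
  · intro h i j hi hij hj
    exact ⟨fun hp => (isPal_iff_palOn.1
        (IsPal.of_PF_eq hlen h (isPal_iff_palOn.2 ⟨hi, hij, by omega, hp⟩))).2.2.2,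
      fun hp => (isPal_iff_palOn.1
        (IsPal.of_PF_eq hlen.symm h.symm (isPal_iff_palOn.2 ⟨hi, hij, by omega, hp⟩))).2.2.2⟩
  · intro H
    have hiff : ∀ i j, IsPal v i j ↔ IsPal w i j := fun i j => by
      rw [isPal_iff_palOn, isPal_iff_palOn, hlen]
      exact and_congr_right fun hi => and_congr_right fun hij => and_congr_right fun hj =>
        H i j hi hij hj
    ext ⟨i, j⟩
    simp only [PF, IsMaxPal, hiff]

theorem letter_map (f : α → β) (w : List α) (i : ℕ) :
    letter (w.map f) i = (letter w i).map f := by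
  simp [letter]

theorem letter_eq_getElem {w : List α} {i : ℕ} (hi : i < w.length) :
    letter w (i + 1) = some w[i] := by
  simp [letter, hi]

/-- Words with the same kernel are injective renamings of each other. -/
theorem exists_injOn_map_eq {v : List α} {w : List β} (hlen : w.length = v.length)
    (hne : w ≠ []) (H : ∀ s t, 1 ≤ s → s ≤ v.length → 1 ≤ t → t ≤ v.length →
      (letter w s = letter w t ↔ letter v s = letter v t)) :
    ∃ f : α → β, Set.InjOn f {c | c ∈ v} ∧ w = v.map f := by
  have key : ∀ s t (hs : s < v.length) (ht : t < v.length),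
      w[s] = w[t] ↔ v[s] = v[t] := fun s t hs ht => by
    have := H (s + 1) (t + 1) (by omega) (by omega) (by omega) (by omega)
    rwa [letter_eq_getElem hs, letter_eq_getElem ht, letter_eq_getElem (by omega),
      letter_eq_getElem (by omega), Option.some_inj, Option.some_inj] at this
  have hex : ∀ c ∈ v, ∃ b, ∃ s, ∃ hs : s < v.length, v[s] = c ∧ w[s] = b := by
    intro c hc
    obtain ⟨s, hs, e⟩ := List.getElem_of_mem hc
    exact ⟨_, s, hs, e, rfl⟩
  -- `choose!` needs a default value for letters outside `v`; this is the role of `hne`.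
  have : Nonempty β := ⟨w.head hne⟩
  choose! f hf using hex
  refine ⟨f, fun c hc d hd e => ?_, ?_⟩
  · obtain ⟨s, hs, hs1, hs2⟩ := hf c hc
    obtain ⟨t, ht, ht1, ht2⟩ := hf d hd
    rw [← hs1, ← ht1, ← key s t hs ht, hs2, ht2, e]
  · refine List.ext_getElem (by simpa using hlen) fun t ht _ => ?_
    obtain ⟨s, hs, hs1, hs2⟩ := hf v[t] (List.getElem_mem _)
    rw [List.getElem_map, ← hs2, key t s (by omega) hs, hs1]

theorem palOn_letter_append {A B C : List α} (hB : B.reverse = B) :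
    PalOn (letter (A ++ B ++ C)) (A.length + 1) (A.length + B.length) := by
  have hget : ∀ t < B.length, letter (A ++ B ++ C) (A.length + 1 + t) = B[t]? := fun t ht => by
    rw [letter, List.append_assoc, List.getElem?_append_right (by omega),
      List.getElem?_append_left (by omega)]
    congr 1; omega
  intro a b hab ha hb
  obtain ⟨s, rfl⟩ := Nat.exists_eq_add_of_le ha
  obtain ⟨t, rfl⟩ := Nat.exists_eq_add_of_le hb
  rw [hget s (by omega), hget t (by omega), ← hB, List.getElem?_reverse (by omega), hB]
  congr 1; omega

/-! ### Zimin words -/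

theorem length_zimin (m : ℕ) : (zimin m).length = 2 ^ m - 1 := by
  induction m with
  | zero => rfl
  | succ m ih =>
    have := Nat.one_le_two_pow (n := m)
    simp only [zimin, List.length_append, ih, List.length_singleton, pow_succ]
    omega

theorem reverse_zimin (m : ℕ) : (zimin m).reverse = zimin m := by
  induction m with
  | zero => rfl
  | succ m ih => simp [zimin, ih]

theorem mem_zimin {m c : ℕ} : c ∈ zimin m ↔ 1 ≤ c ∧ c ≤ m := by
  induction m with
  | zero => simp [zimin]; omega
  | succ m ih => simp [zimin, ih]; omega

theorem zimin_suffix {i m : ℕ} (h : i ≤ m) : zimin i <:+ zimin m := by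
  induction m, h using Nat.le_induction with
  | base => exact List.suffix_refl _
  | succ m _ ih => exact ih.trans (List.suffix_append _ _)

/-- The suffix `zimin i` is preceded by `i + 1`; the index, counted from `0`, is `(2 ^ m - 1) - (2 ^
i - 1) - 1`. -/
theorem getElem?_zimin {i m : ℕ} (h : i < m) : (zimin m)[2 ^ m - 2 ^ i - 1]? = some (i + 1) := by
  induction m with
  | zero => omega
  | succ m ih =>
    have hpos := Nat.one_le_two_pow (n := m)
    have hlen := length_zimin m
    rw [zimin, pow_succ]
    rcases (Nat.lt_succ_iff.1 h).eq_or_lt with rfl | h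
    · rw [List.append_assoc, List.getElem?_append_right (by omega),
        show 2 ^ i * 2 - 2 ^ i - 1 - (zimin i).length = 0 by omega]
      rfl
    · have := Nat.pow_lt_pow_right (a := 2) (by norm_num) h
      rw [List.getElem?_append_right (by simp; omega), ← ih h]
      congr 1
      simp only [List.length_append, List.length_singleton]
      omega

theorem ziminLike_letter {m x y : ℕ} (hx : x ∉ zimin m) (hy : y ∉ zimin m) (hxy : x ≠ y) :
    ZiminLike (letter ([x] ++ zimin m ++ [y])) m := by
  have hlen := length_zimin m
  have hpos := Nat.one_le_two_pow (n := m)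
  have hinner : ∀ i < m, letter ([x] ++ zimin m ++ [y]) (2 ^ m - 2 ^ i + 1) = some (i + 1) := by
    intro i hi
    have := Nat.pow_lt_pow_right (a := 2) (by norm_num) hi
    have := Nat.one_le_two_pow (n := i)
    rw [letter, List.append_assoc, List.getElem?_append_right (by simp; omega),
      List.getElem?_append_left (by simp; omega), ← getElem?_zimin hi]
    rfl
  have hfirst : letter ([x] ++ zimin m ++ [y]) (2 ^ m - 2 ^ m + 1) = some x := by simp [letter]
  have hlast : letter ([x] ++ zimin m ++ [y]) (2 ^ m + 1) = some y := by
    rw [letter, List.getElem?_append_right (by simp; omega),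
      show 2 ^ m + 1 - 1 - ([x] ++ zimin m).length = 0 by simp; omega]
    rfl
  have hmem : ∀ i < m, i + 1 ∈ zimin m := fun i hi => mem_zimin.2 (by omega)
  refine ⟨fun i hi => ?_, fun i j hij hj => ?_, fun i hi => ?_⟩
  · obtain ⟨D, hD⟩ := zimin_suffix hi
    have hl : D.length + (2 ^ i - 1) = 2 ^ m - 1 := by
      rw [← length_zimin i, ← List.length_append, hD, hlen]
    have := Nat.one_le_two_pow (n := i)
    have hp := palOn_letter_append (A := [x] ++ D) (C := [y]) (reverse_zimin i)
    rw [List.append_assoc [x], hD, length_zimin, List.length_append, List.length_singleton] at hp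
    rwa [show 1 + D.length + 1 = 2 ^ m - 2 ^ i + 2 by omega,
      show 1 + D.length + (2 ^ i - 1) = 2 ^ m by omega] at hp
  · rw [hinner i (by omega)]
    rcases hj.eq_or_lt with rfl | hj
    · rw [hfirst, Ne, Option.some_inj]
      rintro rfl; exact hx (hmem i hij)
    · rw [hinner j hj, Ne, Option.some_inj]; omega
  · rw [hlast]
    rcases hi.eq_or_lt with rfl | hi
    · rwa [hfirst, Ne, Option.some_inj]
    · rw [hinner i hi, Ne, Option.some_inj]
      rintro rfl; exact hy (hmem i hi)

theorem card_toFinset_zimin_bordered {m x y : ℕ} (hx : x ∉ zimin m) (hy : y ∉ zimin m)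
    (hxy : x ≠ y) : ([x] ++ zimin m ++ [y]).toFinset.card = m + 2 := by
  have h1 : ([x] ++ zimin m ++ [y]).toFinset = insert x (insert y (Finset.Icc 1 m)) := by
    ext c
    simp [mem_zimin]
  rw [mem_zimin] at hx hy
  rw [h1, Finset.card_insert_of_notMem (by simp [hxy]; omega),
    Finset.card_insert_of_notMem (by simp; omega), Nat.card_Icc]
  omega

/-! ### Fingerprints that need many letters -/

/-- A fingerprint of length at most `2 ^ m + 1` that needs more than `m + 1` letters is the
fingerprint of Zimin-like words only. -/
theorem ziminLike_of_requiresChars {w : List α} {m k : ℕ} (hk : m + 1 < k)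
    (hlen : w.length ≤ 2 ^ m + 1) (H : RequiresChars (PF w) w.length k) :
    w.length = 2 ^ m + 1 ∧ ZiminLike (letter w) m := by
  refine (exists_samePal_or_ziminLike (letter w) hlen).resolve_left ?_
  rintro ⟨g, hg, hs⟩
  have hl : ((List.range w.length).map fun t => g (t + 1)).length = w.length := by simp
  have hpre : PF ((List.range w.length).map fun t => g (t + 1)) = PF w := by
    refine (PF_eq_iff_samePal hl).2 fun i j hi hij hj => ?_
    rw [← hs i j hi hij hj]
    refine palOn_congr_kernel (n := w.length) (fun s t hs1 hs2 ht1 ht2 => ?_) hi hj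
    have hat : ∀ s, 1 ≤ s → s ≤ w.length →
        letter ((List.range w.length).map fun t => g (t + 1)) s = some (g s) := by
      intro s h1 h2
      obtain ⟨r, rfl⟩ := Nat.exists_eq_add_of_le' h1
      rw [letter_eq_getElem (by simpa using h2)]
      simp
    rw [hat s hs1 hs2, hat t ht1 ht2, Option.some_inj]
  have hcard := H _ ⟨hl, hpre⟩
  have hsub : ((List.range w.length).map fun t => g (t + 1)).toFinset ⊆ Finset.range (m + 1) := by
    intro c hc
    simp only [List.mem_toFinset, List.mem_map] at hc
    obtain ⟨t, -, rfl⟩ := hc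
    exact Finset.mem_range.2 (hg _)
  have := Finset.card_le_card hsub
  rw [Finset.card_range] at this
  omega

theorem isPreimage_zimin_bordered_iff {m x y : ℕ} (hx : x ∉ zimin m) (hy : y ∉ zimin m)
    (hxy : x ≠ y) {S : List ℕ} (hS : S = [x] ++ zimin m ++ [y]) (w : List α) :
    IsPreimage w (PF S) S.length ↔
      ∃ f : ℕ → α, Set.InjOn f {c | c ∈ S} ∧ w = S.map f := by
  have hlen : S.length = 2 ^ m + 1 := by
    have := Nat.one_le_two_pow (n := m)
    simp only [hS, List.length_append, List.length_singleton, length_zimin]; omega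
  have hZ : ZiminLike (letter S) m := hS ▸ ziminLike_letter hx hy hxy
  constructor
  · rintro ⟨hl, hPF⟩
    have hs := (PF_eq_iff_samePal hl).1 hPF
    rw [hlen] at hs
    have hne : 0 < w.length := by rw [hl, hlen]; positivity
    refine exists_injOn_map_eq hl (List.ne_nil_of_length_pos hne) ?_
    rw [hlen]
    exact (hZ.of_samePal hs).kernel_eq hZ
  · rintro ⟨f, hf, rfl⟩
    refine ⟨by simp, (PF_eq_iff_samePal (by simp)).2 fun i j hi _ hj =>
      palOn_congr_kernel (n := S.length) (fun s t hs1 hs2 ht1 ht2 => ?_) hi hj⟩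
    obtain ⟨s, rfl⟩ := Nat.exists_eq_add_of_le' hs1
    obtain ⟨t, rfl⟩ := Nat.exists_eq_add_of_le' ht1
    rw [letter_map, letter_map, letter_eq_getElem (by omega), letter_eq_getElem (by omega),
      Option.map_some, Option.map_some, Option.some_inj, Option.some_inj]
    exact hf.eq_iff (List.getElem_mem _) (List.getElem_mem _)

end Lists

end PalFingerprint

theorem lemmal (k : ℕ) (hk : 3 ≤ k) (x y : ℕ)
    (hx : x ∉ PalFingerprint.zimin (k - 2)) (hy : y ∉ PalFingerprint.zimin (k - 2))
    (hxy : x ≠ y) (S : List ℕ) (hS : S = [x] ++ PalFingerprint.zimin (k - 2) ++ [y]) :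
    -- the fingerprint of `S` cannot be reconstructed with fewer than `k` characters
    PalFingerprint.RequiresChars (PalFingerprint.PF S) S.length k ∧
    -- no shorter palindromic fingerprint has this property
    (∀ (F : Set (ℕ × ℕ)) (n : ℕ), PalFingerprint.IsFingerprint F n →
      PalFingerprint.RequiresChars F n k → S.length ≤ n) ∧
    -- no other palindromic fingerprint of the same length has this property
    (∀ F : Set (ℕ × ℕ), PalFingerprint.IsFingerprint F S.length →
      PalFingerprint.RequiresChars F S.length k → F = PalFingerprint.PF S) ∧
    -- the preimages are, over any alphabet, exactly the injective renamings of `S`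
    (∀ (α : Type*) (w : List α),
      PalFingerprint.IsPreimage w (PalFingerprint.PF S) S.length ↔
        ∃ f : ℕ → α, Set.InjOn f {c | c ∈ S} ∧ w = S.map f) := by
  -- With `k = m + 2`, needing `k` letters means exactly that the `m + 1` letters of the greedy
  -- construction do not suffice.
  obtain ⟨m, rfl⟩ : ∃ m, k = m + 2 := ⟨k - 2, by omega⟩
  rw [Nat.add_sub_cancel] at hx hy hS
  have hlen : S.length = 2 ^ m + 1 := by
    have := Nat.one_le_two_pow (n := m)
    simp [hS, PalFingerprint.length_zimin]; omega
  have hZ : PalFingerprint.ZiminLike (PalFingerprint.letter S) m :=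
    hS ▸ PalFingerprint.ziminLike_letter hx hy hxy
  refine ⟨fun w hw => ?_, ?_, ?_, fun α w =>
    PalFingerprint.isPreimage_zimin_bordered_iff hx hy hxy hS w⟩
  · obtain ⟨f, hf, rfl⟩ := (PalFingerprint.isPreimage_zimin_bordered_iff hx hy hxy hS w).1 hw
    have himg : (S.map f).toFinset = S.toFinset.image f := by ext; simp
    rw [himg, Finset.card_image_of_injOn (by simpa using hf), hS,
      PalFingerprint.card_toFinset_zimin_bordered hx hy hxy]
  · rintro F n ⟨w, rfl, rfl⟩ hreq
    by_contra hn
    have := (PalFingerprint.ziminLike_of_requiresChars (m := m) (by omega) (by omega) hreq).1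
    omega
  · rintro F ⟨w, hl, rfl⟩ hreq
    rw [← hl] at hreq
    have hw := (PalFingerprint.ziminLike_of_requiresChars (m := m) (by omega) (by omega) hreq).2
    refine (PalFingerprint.PF_eq_iff_samePal hl).2 fun i j hi _ hj =>
      PalFingerprint.palOn_congr_kernel (n := S.length) ?_ hi hj
    rw [hlen]
    exact hw.kernel_eq hZ
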